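/- Let $K$ be a field and let $G$ be a finite simple graph with vertex set $V$. Write $R=K[x_v : v\in V]$, identify an edge $\{u,v\}$ with the monomial $x_ux_v\in R$, and for a graph $H$ on $V$ let $I(H)\subseteq R$ be its edge ideal, generated by the monomials $x_ux_v$ with $\{u,v\}\in E(H)$. A graph $H$ on $V$ is called very well-covered if all its minimal vertex covers have the same number of elements, it has no isolated vertices, and the height of $I(H)$ is $|V|/2$. An ideal of $R$ is called squarefree if it is generated by squarefree monomials. Suppose that $G$ is very well-covered. Let $s\ge 1$ and let $e_1,\dots,e_s$ be edges of $G$, not necessarily distinct, such that the colon ideal $J=(I(G)^{s+1} : e_1\cdots e_s)$ is squarefree. Let $G'$ be the graph associated to $J$, that is, the graph on $V$ in which distinct vertices $u,v$ are adjacent if and only if $x_ux_v\in J$. Then $I(G')=J$, and $G'$ is very well-covered. -/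

import Mathlib

namespace EdgeIdealPowers

/-- The quadratic monomial `x_u * x_v` of the edge `s(u, v)`, in `K[x_v : v ∈ V]`. -/
noncomputable def edgeMonomial (K : Type*) [Field K] {V : Type*} (e : Sym2 V) :
    MvPolynomial V K :=
  Sym2.mul (e.map (fun v => (MvPolynomial.X v : MvPolynomial V K)))

/-- The edge ideal `I(G)`, generated by the monomials of the edges of `G`. -/
noncomputable def edgeIdeal (K : Type*) [Field K] {V : Type*} (G : SimpleGraph V) :
    Ideal (MvPolynomial V K) :=
  Ideal.span (edgeMonomial K '' G.edgeSet)

/-- A minimal vertex cover: a vertex cover that is minimal with respect to inclusion. -/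
def IsMinimalVertexCover {V : Type*} (G : SimpleGraph V) (C : Set V) : Prop :=
  Minimal G.IsVertexCover C

/-- A (finite) graph is unmixed, or well-covered, if all its minimal vertex covers have the
same number of elements. -/
def IsUnmixed {V : Type*} (G : SimpleGraph V) : Prop :=
  ∀ C D : Set V, IsMinimalVertexCover G C → IsMinimalVertexCover G D → C.ncard = D.ncard

/-- A (finite) graph `G` is very well-covered if it is unmixed, has no isolated vertices, and
the height of its edge ideal is `|V(G)| / 2`. -/
structure IsVeryWellCovered (K : Type*) [Field K] {V : Type*} (G : SimpleGraph V) : Prop where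
  unmixed : IsUnmixed G
  no_isolated : ∀ v : V, ¬ G.IsIsolated v
  height_eq : 2 * (edgeIdeal K G).height = (Nat.card V : ℕ∞)

/-- A squarefree monomial ideal: an ideal generated by squarefree monomials, i.e. by products
of distinct variables. -/
def IsSquarefreeMonomialIdeal {K : Type*} [Field K] {V : Type*}
    (J : Ideal (MvPolynomial V K)) : Prop :=
  ∃ S : Set (Finset V),
    J = Ideal.span ((fun t : Finset V => ∏ v ∈ t, (MvPolynomial.X v : MvPolynomial V K)) '' S)

/-- The graph associated to an ideal `J` of `K[x_v : v ∈ V]`: distinct vertices `u`, `v` are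
adjacent if and only if `x_u * x_v ∈ J`. If `J` is the edge ideal of a graph, this recovers
that graph. -/
def associatedGraph {K : Type*} [Field K] {V : Type*} (J : Ideal (MvPolynomial V K)) :
    SimpleGraph V where
  Adj u v := u ≠ v ∧ edgeMonomial K s(u, v) ∈ J
  symm := ⟨fun u v h => ⟨h.1.symm, by rw [Sym2.eq_swap]; exact h.2⟩⟩
  loopless := ⟨fun _ h => h.1 rfl⟩

/-- The colon ideal `(I(G)^{s+1} : e_1 ⋯ e_s)`. -/
noncomputable def edgeColon (K : Type*) [Field K] {V : Type*} (G : SimpleGraph V) {s : ℕ}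
    (e : Fin s → Sym2 V) : Ideal (MvPolynomial V K) :=
  Submodule.colon (edgeIdeal K G ^ (s + 1)) {∏ i, edgeMonomial K (e i)}

end EdgeIdealPowers

/-!
Write `J = (I(G)^{s+1} : e_1 ⋯ e_s)` and let `G'` be its associated graph.

*Alternating walks.* Two vertices `u`, `v` are even-connected if some walk from `u` to `v`
alternates between edges of `G` and the `e_i`, begins and ends with an edge of `G`, and passes each
`e_i` at most once. The edges of `G` on such a walk show that `x_u x_v ∈ J`
(`IsAlternatingWalk.mul_mem_edgeColon`). Conversely, a monomial in `J` is divisible by `x_u x_v`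
for some even-connected `u`, `v` (`exists_isAlternatingWalk`). By induction on `s`: if `μ e_1 ⋯ e_s`
is divisible by `s + 1` edges, one of these edges is `{u, p}` with `x_u` dividing `μ`; if `p` does
not come from `μ` as well, it comes from some `e_i = {p, q}`; remove `{u, p}` and `e_i`, replace
`x_u` by `x_q` in `μ`, and extend the walk obtained for the smaller problem if it ends at `q`.
As `J` is squarefree, `u ≠ v` throughout, so `J = I(G')`, no vertex is even-connected to itself,
and adjacency in `G'` is even-connectedness.

*Very well-covered graphs.* The height of `I(G)` is the least size of a vertex cover, and `G` is
very well-covered if and only if it has a perfect matching such that, for each matching edge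
`{x, y}`, every neighbour of `x` is adjacent to every neighbour of `y` (`IsFavaronMatching`). The
matching comes from Hall's theorem (`IsVeryWellCovered.exists_isFavaronMatching`); conversely, such
a matching forces a minimal vertex cover to contain exactly one end of each of its edges.

*The same matching works for `G'`* (`IsFavaronMatching.associatedGraph_edgeColon`). If `a`, `x` and
`y`, `b` are even-connected and `{x, y}` is in the matching, the two walks can be joined by omitting
`x` and `y`. The joined walk from `a` to `b` may pass some `e_i` twice. If it does so in the same
direction, it can be shortened; if it does so in opposite directions, it contains a shorter closed
walk. Hence either `a` and `b` are even-connected, or some vertex is even-connected to itself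
(`IsAlternatingWalk.exists_nodup`), and the latter is excluded.
-/

namespace EdgeIdealPowers

/-! ### The height of an edge ideal -/

theorem edgeMonomial_mk (K : Type*) [Field K] {V : Type*} (u v : V) :
    edgeMonomial K s(u, v) = MvPolynomial.X u * MvPolynomial.X v := rfl

theorem edgeMonomial_mem_edgeIdeal (K : Type*) [Field K] {V : Type*} {G : SimpleGraph V}
    {e : Sym2 V} (he : e ∈ G.edgeSet) : edgeMonomial K e ∈ edgeIdeal K G :=
  Ideal.subset_span ⟨e, he, rfl⟩

/-- The ideal generated by a set of variables is the kernel of the substitution that sends these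
variables to `0` and fixes the others. -/
theorem ker_aeval_eq_span_X (K : Type*) [Field K] {V : Type*} (C : Set V)
    [DecidablePred (· ∈ C)] :
    RingHom.ker (MvPolynomial.aeval (R := K)
      (fun v => if v ∈ C then (0 : MvPolynomial V K) else MvPolynomial.X v)) =
      Ideal.span (MvPolynomial.X '' C) := by
  set φ := MvPolynomial.aeval (R := K)
      (fun v => if v ∈ C then (0 : MvPolynomial V K) else MvPolynomial.X v) with hφ
  apply le_antisymm
  · intro f hf
    have key : ∀ f : MvPolynomial V K, f - φ f ∈ Ideal.span (MvPolynomial.X '' C) := by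
      intro f
      induction f using MvPolynomial.induction_on with
      | C a => simp [hφ, MvPolynomial.algebraMap_eq]
      | add p q hp hq =>
        rw [map_add, add_sub_add_comm]
        exact Ideal.add_mem _ hp hq
      | mul_X p v hp =>
        have hv : (MvPolynomial.X v : MvPolynomial V K) - φ (MvPolynomial.X v) ∈
            Ideal.span (MvPolynomial.X '' C) := by
          by_cases h : v ∈ C
          · simpa [hφ, h] using Ideal.subset_span (Set.mem_image_of_mem _ h)
          · simp [hφ, h]
        have : p * MvPolynomial.X v - φ (p * MvPolynomial.X v) =
            p * (MvPolynomial.X v - φ (MvPolynomial.X v)) +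
              φ (MvPolynomial.X v) * (p - φ p) := by
          rw [map_mul]; ring
        rw [this]
        exact Ideal.add_mem _ (Ideal.mul_mem_left _ _ hv) (Ideal.mul_mem_left _ _ hp)
    have := key f
    rwa [(RingHom.mem_ker).1 hf, sub_zero] at this
  · rw [Ideal.span_le]
    rintro _ ⟨v, hv, rfl⟩
    have : φ (MvPolynomial.X v) = 0 := by simp [hφ, hv]
    exact this

theorem isPrime_span_X (K : Type*) [Field K] {V : Type*} (C : Set V) :
    (Ideal.span (MvPolynomial.X '' C : Set (MvPolynomial V K))).IsPrime := by
  classical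
  rw [← ker_aeval_eq_span_X K C]
  exact RingHom.ker_isPrime _

theorem X_mem_span_X_iff (K : Type*) [Field K] {V : Type*} (C : Set V) (v : V) :
    (MvPolynomial.X v : MvPolynomial V K) ∈ Ideal.span (MvPolynomial.X '' C) ↔ v ∈ C := by
  classical
  rw [← ker_aeval_eq_span_X K C, RingHom.mem_ker]
  by_cases h : v ∈ C <;> simp [h]

/-- Adding the variables of `C` one at a time gives a chain of primes. -/
theorem card_le_height_span_X (K : Type*) [Field K] {V : Type*} (C : Finset V) :
    (C.card : ℕ∞) ≤
      (Ideal.span (MvPolynomial.X '' (C : Set V) : Set (MvPolynomial V K))).height := by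
  classical
  induction C using Finset.induction_on with
  | empty => simp
  | insert v C hv ih =>
    have h1 := isPrime_span_X K (C : Set V)
    have h2 := isPrime_span_X K ((insert v C : Finset V) : Set V)
    have hlt : Ideal.span (MvPolynomial.X '' (C : Set V) : Set (MvPolynomial V K)) <
        Ideal.span (MvPolynomial.X '' ((insert v C : Finset V) : Set V)) := by
      refine lt_of_le_of_ne (Ideal.span_mono (Set.image_mono (by simp))) fun h => hv ?_
      have hm := (X_mem_span_X_iff K ((insert v C : Finset V) : Set V) v).2 (by simp)
      rw [← h, X_mem_span_X_iff] at hm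
      exact_mod_cast hm
    rw [Finset.card_insert_of_notMem hv, Nat.cast_add, Nat.cast_one]
    exact (add_le_add_left ih 1).trans (Ideal.height_add_one_le_of_lt_of_isPrime hlt)

theorem height_edgeIdeal_le_ncard (K : Type*) [Field K] {V : Type*} [Finite V]
    {G : SimpleGraph V} {C : Set V} (hC : G.IsVertexCover C) :
    (edgeIdeal K G).height ≤ (C.ncard : ℕ∞) := by
  have hle : edgeIdeal K G ≤ Ideal.span (MvPolynomial.X '' C) := by
    refine Ideal.span_le.2 ?_
    rintro _ ⟨e, he, rfl⟩
    induction e with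
    | _ u v =>
      rw [edgeMonomial_mk]
      rcases hC (show G.Adj u v from he) with h | h
      · exact Ideal.mul_mem_right _ _ ((X_mem_span_X_iff K C u).2 h)
      · exact Ideal.mul_mem_left _ _ ((X_mem_span_X_iff K C v).2 h)
  have hp := isPrime_span_X K C
  have hfin : (MvPolynomial.X '' C : Set (MvPolynomial V K)).Finite := C.toFinite.image _
  refine (Ideal.height_mono hle).trans ?_
  refine (Ideal.height_le_card_of_mem_minimalPrimes_span hfin
    (by rw [Ideal.minimalPrimes_eq_subsingleton_self]; rfl)).trans ?_
  exact_mod_cast Set.ncard_image_le C.toFinite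

theorem exists_isVertexCover_ncard_le_height (K : Type*) [Field K] {V : Type*} [Finite V]
    (G : SimpleGraph V) :
    ∃ C : Set V, G.IsVertexCover C ∧ (C.ncard : ℕ∞) ≤ (edgeIdeal K G).height := by
  -- The variables in a prime over `I(G)` of least height form a vertex cover.
  by_contra! hcon
  have hne : edgeIdeal K G ≠ ⊤ := by
    intro h
    have := hcon Set.univ (by simp)
    rw [h, Ideal.height_top] at this
    exact not_top_lt this
  obtain ⟨P0, hP0⟩ := Ideal.nonempty_minimalPrimes hne
  obtain ⟨⟨P, hP⟩, hPh⟩ := @ENat.exists_eq_iInf (edgeIdeal K G).minimalPrimes ⟨⟨P0, hP0⟩⟩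
    (fun p => p.1.height)
  have hPp : P.IsPrime := hP.1.1
  let C : Set V := {v | (MvPolynomial.X v : MvPolynomial V K) ∈ P}
  have hC : G.IsVertexCover C := by
    intro u v huv
    have := hP.1.2 (edgeMonomial_mem_edgeIdeal K (e := s(u, v)) huv)
    rw [edgeMonomial_mk] at this
    exact hPp.mem_or_mem this
  have hh : P.height = (edgeIdeal K G).height := by
    rw [(edgeIdeal K G).height_eq_inf_minimalPrimes, ← iInf_subtype'', ← hPh]
  have hlt := hcon C hC
  rw [← hh] at hlt
  have h1 := card_le_height_span_X K C.toFinite.toFinset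
  rw [Set.Finite.coe_toFinset, ← Set.ncard_eq_toFinset_card C] at h1
  have h2 : Ideal.span (MvPolynomial.X '' C : Set (MvPolynomial V K)) ≤ P := by
    rw [Ideal.span_le]
    rintro _ ⟨v, hv, rfl⟩
    exact hv
  exact absurd (h1.trans (Ideal.height_mono h2)) (not_le.2 hlt)

/-! ### Perfect matchings of very well-covered graphs -/

/-- An independent set extends to one whose complement is a minimal vertex cover. -/
theorem exists_superset_isMinimalVertexCover_compl {V : Type*} [Finite V] {G : SimpleGraph V}
    {A : Set V} (hA : G.IsIndepSet A) : ∃ T, A ⊆ T ∧ IsMinimalVertexCover G Tᶜ := by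
  obtain ⟨C, hC, hmin⟩ := exists_minimal_le_of_wellFoundedLT G.IsVertexCover Aᶜ
    (by simpa using hA)
  exact ⟨Cᶜ, Set.subset_compl_comm.1 hC, by rwa [compl_compl]⟩

theorem IsVeryWellCovered.two_mul_ncard_eq {K : Type*} [Field K] {V : Type*} [Finite V]
    {G : SimpleGraph V} (hG : IsVeryWellCovered K G) {C : Set V}
    (hC : IsMinimalVertexCover G C) : 2 * C.ncard = Nat.card V := by
  obtain ⟨D, hD, hDh⟩ := exists_isVertexCover_ncard_le_height K G
  obtain ⟨D', hD', hmin⟩ := exists_minimal_le_of_wellFoundedLT G.IsVertexCover D hD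
  have h1 := Set.ncard_le_ncard hD'
  rw [← hG.unmixed C D' hC hmin] at h1
  have h2 : (C.ncard : ℕ∞) ≤ (edgeIdeal K G).height := le_trans (by exact_mod_cast h1) hDh
  have h3 := le_antisymm h2 (height_edgeIdeal_le_ncard K hC.1)
  have h4 := hG.height_eq
  rw [← h3] at h4
  exact_mod_cast h4

/-- A perfect matching, given as the involution `m` that swaps the ends of each of its edges, such
that every neighbour of one end of a matching edge is adjacent to every neighbour of the other
end. As graphs have no loops, no triangle contains a matching edge. -/
structure IsFavaronMatching {V : Type*} (G : SimpleGraph V) (m : V → V) : Prop where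
  involutive : Function.Involutive m
  adj : ∀ v, G.Adj v (m v)
  adj_of_adj : ∀ ⦃v a b⦄, G.Adj a v → G.Adj b (m v) → G.Adj a b

/-- An independent set of half the vertices meets every edge of a perfect matching. -/
theorem mem_or_mem_of_isIndepSet {V : Type*} [Finite V] {G : SimpleGraph V} {m : V → V}
    (hm : Function.Involutive m) (hadj : ∀ v, G.Adj v (m v)) {T : Set V} (hT : G.IsIndepSet T)
    (hcard : 2 * Tᶜ.ncard = Nat.card V) (v : V) : v ∈ T ∨ m v ∈ T := by
  have h1 : m '' T ⊆ Tᶜ := by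
    rintro _ ⟨t, ht, rfl⟩ h
    exact hT ht h (hadj t).ne (hadj t)
  have h2 : (m '' T).ncard = T.ncard := Set.ncard_image_of_injective _ hm.injective
  have h3 := Set.ncard_add_ncard_compl T
  have h4 : m '' T = Tᶜ := Set.eq_of_subset_of_ncard_le h1 (by omega)
  by_cases hv : v ∈ T
  · exact Or.inl hv
  · rw [← Set.mem_compl_iff, ← h4] at hv
    obtain ⟨t, ht, rfl⟩ := hv
    rw [hm t]
    exact Or.inr ht

theorem IsFavaronMatching.two_mul_ncard_eq {V : Type*} [Finite V] {G : SimpleGraph V}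
    {m : V → V} (hm : IsFavaronMatching G m) {C : Set V} (hC : IsMinimalVertexCover G C) :
    2 * C.ncard = Nat.card V := by
  -- A vertex of a minimal cover has a neighbour outside it.
  have hnb : ∀ v ∈ C, ∃ a, a ∉ C ∧ G.Adj a v := by
    intro v hv
    by_contra! h
    have hcov : G.IsVertexCover (C \ {v}) := by
      intro a b hab
      have hab' := hC.1 hab
      by_cases hav : a = v
      · subst hav
        refine Or.inr ⟨?_, hab.ne'⟩
        by_contra hb
        exact h b hb hab.symm
      · by_cases hbv : b = v
        · subst hbv
          refine Or.inl ⟨?_, hab.ne⟩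
          by_contra ha
          exact h a ha hab
        · exact hab'.imp (fun x => ⟨x, hav⟩) (fun x => ⟨x, hbv⟩)
    exact (hC.2 hcov Set.sdiff_subset hv).2 rfl
  have himg : m '' C = Cᶜ := by
    ext w
    constructor
    · rintro ⟨v, hv, rfl⟩ hmv
      obtain ⟨a, ha, hav⟩ := hnb v hv
      obtain ⟨b, hb, hbv⟩ := hnb _ hmv
      exact (hC.1 (hm.adj_of_adj hav hbv)).elim ha hb
    · intro hw
      exact ⟨m w, (hC.1 (hm.adj w)).resolve_left hw, hm.involutive w⟩
  have h2 : (m '' C).ncard = C.ncard := Set.ncard_image_of_injective _ hm.involutive.injective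
  have h3 := Set.ncard_add_ncard_compl C
  rw [← himg, h2] at h3
  omega

/-- If every vertex of a graph without isolated vertices lies in a maximum independent set, then
Hall's condition holds for every independent set. -/
theorem card_le_card_biUnion_neighborFinset {V : Type*} [Fintype V] [DecidableEq V]
    (G : SimpleGraph V) [DecidableRel G.Adj] (hiso : ∀ v, ¬ G.IsIsolated v) (n : ℕ)
    (hmax : ∀ T : Finset V, G.IsIndepSet T → T.card ≤ n)
    (hext : ∀ v, ∃ T : Finset V, v ∈ T ∧ G.IsIndepSet T ∧ T.card = n)
    (A : Finset V) (hA : G.IsIndepSet A) :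
    A.card ≤ (A.biUnion (G.neighborFinset ·)).card := by
  induction A using Finset.strongInduction with
  | H A ih =>
    rcases A.eq_empty_or_nonempty with rfl | ⟨a, ha⟩
    · simp
    obtain ⟨b, hab⟩ : ∃ b, G.Adj a b := by
      have := hiso a
      unfold SimpleGraph.IsIsolated at this
      push Not at this
      exact this
    obtain ⟨T, hbT, hT, hTn⟩ := hext b
    set N := A.biUnion (G.neighborFinset ·) with hN
    have hNmem : ∀ x, x ∈ N ↔ ∃ y ∈ A, G.Adj y x := by simp [hN]
    -- Replacing `T ∩ N(A)` by `A` in `T` gives an independent set.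
    have hind : G.IsIndepSet ((T \ N ∪ A : Finset V) : Set V) := by
      intro x hx y hy hxy hadj
      simp only [Finset.coe_union, Finset.coe_sdiff, Set.mem_union, Set.mem_sdiff,
        Finset.mem_coe] at hx hy
      rcases hx with ⟨hx, hxN⟩ | hx <;> rcases hy with ⟨hy, hyN⟩ | hy
      · exact hT hx hy hxy hadj
      · exact hxN ((hNmem x).2 ⟨y, hy, hadj.symm⟩)
      · exact hyN ((hNmem y).2 ⟨x, hx, hadj⟩)
      · exact hA hx hy hxy hadj
    have h1 := hmax _ hind
    have hunion : T \ N ∪ A = T \ N ∪ A \ T := by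
      ext x
      simp only [Finset.mem_union, Finset.mem_sdiff]
      by_cases hxT : x ∈ T
      · by_cases hxA : x ∈ A
        · have : x ∉ N := by
            rw [hNmem]
            rintro ⟨y, hy, hyx⟩
            exact hA hy hxA hyx.ne hyx
          simp [hxT, hxA, this]
        · simp [hxT, hxA]
      · simp [hxT]
    have hdisj : Disjoint (T \ N) (A \ T) :=
      Finset.disjoint_left.2 fun x hx hx' =>
        (Finset.mem_sdiff.1 hx').2 (Finset.mem_sdiff.1 hx).1
    rw [hunion, Finset.card_union_of_disjoint hdisj] at h1
    have h2 := Finset.card_sdiff_add_card_inter T N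
    have hss : A ∩ T ⊂ A := by
      refine Finset.ssubset_iff_subset_ne.2 ⟨Finset.inter_subset_left, fun h => ?_⟩
      have haT : a ∈ T := (Finset.mem_inter.1 (h ▸ ha)).2
      exact hT haT hbT hab.ne hab
    have h3 := ih _ hss (hA.mono (by exact_mod_cast hss.1))
    have hsub : (A ∩ T).biUnion (G.neighborFinset ·) ⊆ N \ T := by
      intro x hx
      simp only [Finset.mem_biUnion, Finset.mem_inter, SimpleGraph.mem_neighborFinset] at hx
      obtain ⟨y, ⟨hyA, hyT⟩, hyx⟩ := hx
      exact Finset.mem_sdiff.2 ⟨(hNmem x).2 ⟨y, hyA, hyx⟩, fun hxT => hT hyT hxT hyx.ne hyx⟩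
    have h4 := Finset.card_le_card hsub
    have h5 := Finset.card_sdiff_add_card_inter N T
    have h6 := Finset.card_sdiff_add_card_inter A T
    rw [Finset.inter_comm] at h5
    omega

theorem IsVeryWellCovered.exists_isFavaronMatching {K : Type*} [Field K] {V : Type*} [Fintype V]
    {G : SimpleGraph V} (hG : IsVeryWellCovered K G) : ∃ m, IsFavaronMatching G m := by
  classical
  have hcard : ∀ T : Set V, IsMinimalVertexCover G Tᶜ → 2 * T.ncard = Nat.card V := by
    intro T hT
    have h1 := hG.two_mul_ncard_eq hT
    have h2 := Set.ncard_add_ncard_compl T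
    omega
  have hindep : ∀ T : Set V, IsMinimalVertexCover G Tᶜ → G.IsIndepSet T := fun T hT => by
    simpa using hT.1
  obtain ⟨S, -, hS⟩ := exists_superset_isMinimalVertexCover_compl
    (G := G) (A := ∅) (by simp [SimpleGraph.IsIndepSet])
  have hSi := hindep S hS
  have hall : ∀ A : Finset V, G.IsIndepSet A → A.card ≤ (A.biUnion (G.neighborFinset ·)).card := by
    refine card_le_card_biUnion_neighborFinset G hG.no_isolated S.ncard ?_ ?_
    · intro A hA
      obtain ⟨T, hAT, hT⟩ := exists_superset_isMinimalVertexCover_compl hA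
      have := Set.ncard_le_ncard hAT
      rw [Set.ncard_coe_finset] at this
      have h1 := hcard T hT
      have h2 := hcard S hS
      omega
    · intro v
      obtain ⟨T, hAT, hT⟩ := exists_superset_isMinimalVertexCover_compl
        (G := G) (A := {v}) (by simp [SimpleGraph.IsIndepSet])
      refine ⟨T.toFinset, by simpa using hAT, by simpa using hindep T hT, ?_⟩
      rw [← Set.ncard_eq_toFinset_card']
      have h1 := hcard T hT
      have h2 := hcard S hS
      omega
  obtain ⟨f, hf, hfadj⟩ := (Finset.all_card_le_biUnion_card_iff_exists_injective
    (fun v : S => G.neighborFinset v)).1 (by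
      intro A
      have := hall (A.map (Function.Embedding.subtype _)) (hSi.mono (by
        intro x hx
        simp only [Finset.coe_map, Function.Embedding.subtype_apply, Set.mem_image] at hx
        obtain ⟨y, -, rfl⟩ := hx
        exact y.2))
      rwa [Finset.card_map, Finset.map_eq_image, Finset.image_biUnion] at this)
  have hfa : ∀ v : S, G.Adj v (f v) := fun v => by simpa using hfadj v
  have hfS : ∀ v : S, f v ∉ S := fun v h => hSi v.2 h (hfa v).ne (hfa v)
  have hrange : Set.range f = Sᶜ := by
    refine Set.eq_of_subset_of_ncard_le (by rintro _ ⟨v, rfl⟩; exact hfS v) ?_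
    rw [← Set.image_univ, Set.ncard_image_of_injective _ hf, Set.ncard_univ, Nat.card_coe_set_eq]
    have h1 := hG.two_mul_ncard_eq hS
    have h2 := hcard S hS
    omega
  have hsurj : ∀ v, v ∉ S → ∃ w : S, f w = v := fun v hv => by
    rw [← Set.mem_compl_iff, ← hrange] at hv
    exact hv
  choose g hg using hsurj
  let m : V → V := fun v => if h : v ∈ S then f ⟨v, h⟩ else g v h
  have hmS : ∀ v : S, m v = f v := fun v => by simp [m]
  have hmf : ∀ v : S, m (f v) = v := fun v => by
    have h := hfS v
    simp only [m, h, dite_false]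
    exact congrArg _ (hf (hg _ h))
  have hinv : Function.Involutive m := by
    intro v
    by_cases h : v ∈ S
    · rw [hmS ⟨v, h⟩, hmf]
    · rw [← hg v h, hmf, hmS]
  have hadj : ∀ v, G.Adj v (m v) := by
    intro v
    by_cases h : v ∈ S
    · rw [hmS ⟨v, h⟩]
      exact hfa ⟨v, h⟩
    · rw [← hg v h, hmf]
      exact (hfa _).symm
  refine ⟨m, hinv, hadj, fun v a b hav hbv => ?_⟩
  -- Otherwise `{a, b}` extends to a maximal independent set, which avoids both `v` and `m v`.
  by_contra hab
  obtain ⟨T, hT, hTmin⟩ := exists_superset_isMinimalVertexCover_compl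
    (G := G) (A := {a, b}) (by
      rintro x (rfl | rfl) y (rfl | rfl) hxy h
      · exact hxy rfl
      · exact hab h
      · exact hab h.symm
      · exact hxy rfl)
  have hTi := hindep T hTmin
  have haT : a ∈ T := hT (by simp)
  have hbT : b ∈ T := hT (by simp)
  rcases mem_or_mem_of_isIndepSet hinv hadj hTi (hG.two_mul_ncard_eq hTmin) v with h | h
  · exact hTi haT h hav.ne hav
  · exact hTi hbT h hbv.ne hbv

theorem IsFavaronMatching.isVeryWellCovered (K : Type*) [Field K] {V : Type*} [Finite V]
    {G : SimpleGraph V} {m : V → V} (hm : IsFavaronMatching G m) : IsVeryWellCovered K G where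
  unmixed C D hC hD := by
    have h1 := hm.two_mul_ncard_eq hC
    have h2 := hm.two_mul_ncard_eq hD
    omega
  no_isolated v h := h _ (hm.adj v)
  height_eq := by
    obtain ⟨D, hD, hDh⟩ := exists_isVertexCover_ncard_le_height K G
    obtain ⟨C, hCD, hC⟩ := exists_minimal_le_of_wellFoundedLT G.IsVertexCover D hD
    have hle : (C.ncard : ℕ∞) ≤ (edgeIdeal K G).height :=
      le_trans (by exact_mod_cast Set.ncard_le_ncard hCD) hDh
    rw [← le_antisymm hle (height_edgeIdeal_le_ncard K hC.1), ← hm.two_mul_ncard_eq hC]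
    norm_cast


/-! ### Alternating walks -/

/-- A walk from `u` to `v` of odd length that alternates between edges of `G` and members of the
family `e`, and begins and ends with an edge of `G`. The list holds the triples `(p, q, i)` of the
passages from `p` to `q` along `e i`, in order. -/
def IsAlternatingWalk {V ι : Type*} (G : SimpleGraph V) (e : ι → Sym2 V) :
    V → List (V × V × ι) → V → Prop
  | u, [], v => G.Adj u v
  | u, (p, q, i) :: l, v => G.Adj u p ∧ s(p, q) = e i ∧ IsAlternatingWalk G e q l v

/-- The indices of the members of `e` that a walk passes, with repetitions. -/
abbrev labels {V ι : Type*} (l : List (V × V × ι)) : List ι := l.map fun x => x.2.2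

section

variable {V ι : Type*} {G : SimpleGraph V} {e : ι → Sym2 V}

theorem isAlternatingWalk_append_cons {l l' : List (V × V × ι)} {u v p q : V} {i : ι} :
    IsAlternatingWalk G e u (l ++ (p, q, i) :: l') v ↔
      IsAlternatingWalk G e u l p ∧ s(p, q) = e i ∧ IsAlternatingWalk G e q l' v := by
  induction l generalizing u with
  | nil => rfl
  | cons x l ih =>
    obtain ⟨p', q', i'⟩ := x
    simp only [List.cons_append, IsAlternatingWalk, ih, and_assoc]

theorem IsAlternatingWalk.reverse {l : List (V × V × ι)} {u v : V}
    (h : IsAlternatingWalk G e u l v) :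
    IsAlternatingWalk G e v (l.reverse.map fun x => (x.2.1, x.1, x.2.2)) u := by
  induction l generalizing u with
  | nil => exact SimpleGraph.Adj.symm h
  | cons x l ih =>
    obtain ⟨p, q, i⟩ := x
    rw [List.reverse_cons, List.map_append, List.map_singleton, isAlternatingWalk_append_cons]
    exact ⟨ih h.2.2, by rw [Sym2.eq_swap]; exact h.2.1, h.1.symm⟩

theorem labels_reverse (l : List (V × V × ι)) :
    labels (l.reverse.map fun x => (x.2.1, x.1, x.2.2)) = (labels l).reverse := by
  simp [labels, Function.comp_def]

/-- If every neighbour of `x` is adjacent to every neighbour of `y`, then a walk ending at `x` and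
a walk starting at `y` can be joined by omitting `x` and `y`. -/
theorem IsAlternatingWalk.append {x y : V} (hxy : ∀ a b, G.Adj a x → G.Adj b y → G.Adj a b)
    {l l' : List (V × V × ι)} {u v : V} (h : IsAlternatingWalk G e u l x)
    (h' : IsAlternatingWalk G e y l' v) : IsAlternatingWalk G e u (l ++ l') v := by
  induction l generalizing u with
  | nil =>
    cases l' with
    | nil => exact hxy _ _ h (SimpleGraph.Adj.symm h')
    | cons z l' => exact ⟨hxy _ _ h h'.1.symm, h'.2⟩
  | cons z l ih => exact ⟨h.1, h.2.1, ih h.2.2⟩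

end

theorem exists_eq_append_of_not_nodup_map {α β : Type*} (f : α → β) {l : List α}
    (h : ¬ (l.map f).Nodup) :
    ∃ l₁ x l₂ y l₃, l = l₁ ++ x :: (l₂ ++ y :: l₃) ∧ f x = f y := by
  induction l with
  | nil => simp at h
  | cons x l ih =>
    by_cases hx : f x ∈ l.map f
    · obtain ⟨y, hy, hxy⟩ := List.mem_map.1 hx
      obtain ⟨l₂, l₃, rfl⟩ := List.append_of_mem hy
      exact ⟨[], x, l₂, y, l₃, rfl, hxy.symm⟩
    · obtain ⟨l₁, z, l₂, y, l₃, rfl, hzy⟩ := ih fun hl => h (by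
        rw [List.map_cons, List.nodup_cons]
        exact ⟨hx, hl⟩)
      exact ⟨x :: l₁, z, l₂, y, l₃, rfl, hzy⟩

/-- If some `e i` is passed twice, then either both passages have the same direction and the part
between them can be cut out, or they have opposite directions and the part between them is a
shorter closed walk. -/
theorem IsAlternatingWalk.exists_nodup {V ι : Type*} {G : SimpleGraph V} {e : ι → Sym2 V}
    (l : List (V × V × ι)) {u v : V} (h : IsAlternatingWalk G e u l v) :
    (∃ l', IsAlternatingWalk G e u l' v ∧ (labels l').Nodup) ∨
      ∃ d l', IsAlternatingWalk G e d l' d ∧ (labels l').Nodup := by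
  by_cases hl : (labels l).Nodup
  · exact Or.inl ⟨l, h, hl⟩
  obtain ⟨l₁, ⟨p, q, i⟩, l₂, ⟨p', q', j⟩, l₃, heq, hij⟩ := exists_eq_append_of_not_nodup_map _ hl
  obtain rfl : i = j := hij
  have h' := h
  rw [heq, isAlternatingWalk_append_cons, isAlternatingWalk_append_cons] at h'
  obtain ⟨h1, hpq, h2, hpq', h3⟩ := h'
  rcases Sym2.eq_iff.1 (hpq.trans hpq'.symm) with ⟨rfl, rfl⟩ | ⟨rfl, rfl⟩
  · exact IsAlternatingWalk.exists_nodup (l₁ ++ (p, q, i) :: l₃)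
      (isAlternatingWalk_append_cons.2 ⟨h1, hpq, h3⟩)
  · exact (IsAlternatingWalk.exists_nodup l₂ h2).elim (fun ⟨l', hl'⟩ => Or.inr ⟨_, l', hl'⟩)
      Or.inr
termination_by l.length
decreasing_by all_goals subst heq; simp; try omega

/-- If a multiset of vertices `m` together with the edges `e i`, `i ∈ T`, contains `|T| + 1` edges
of `G`, then some pair of vertices in `m` is joined by an alternating walk that passes each `e i`,
`i ∈ T`, at most once. -/
theorem exists_isAlternatingWalk {V ι : Type*} {G : SimpleGraph V} {e : ι → Sym2 V}
    (T : Finset ι) (m : Multiset V) (F : Multiset (Sym2 V)) (hF : ∀ f ∈ F, f ∈ G.edgeSet)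
    (hcard : F.card = T.card + 1)
    (hle : F.bind Sym2.toMultiset ≤ m + ∑ i ∈ T, (e i).toMultiset) :
    ∃ u v l, {u, v} ≤ m ∧ IsAlternatingWalk G e u l v ∧ (labels l).Nodup ∧
      ∀ i ∈ labels l, i ∈ T := by
  classical
  induction T using Finset.strongInduction generalizing m F with
  | H T ih =>
    -- The `e i` have too few vertices, so one of the `|T| + 1` edges has an end in `m`.
    obtain ⟨u, hu, f, hf, huf⟩ : ∃ u ∈ m, ∃ f ∈ F, u ∈ f := by
      by_contra! hcon
      have hle' : F.bind Sym2.toMultiset ≤ ∑ i ∈ T, (e i).toMultiset := by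
        rw [Multiset.le_iff_count]
        intro v
        by_cases hv : v ∈ m
        · rw [Multiset.count_eq_zero_of_notMem]
          · exact Nat.zero_le _
          · intro h
            obtain ⟨f, hf, hvf⟩ := Multiset.mem_bind.1 h
            exact hcon v hv f hf (Sym2.mem_toMultiset.1 hvf)
        · have := Multiset.le_iff_count.1 hle v
          rwa [Multiset.count_add, Multiset.count_eq_zero_of_notMem hv, zero_add] at this
      have hc := Multiset.card_le_card hle'
      simp only [Multiset.card_bind, Function.comp_def, Sym2.card_toMultiset, Multiset.card_sum,
        Multiset.map_const', Multiset.sum_replicate, Finset.sum_const, smul_eq_mul, hcard] at hc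
      omega
    obtain ⟨p, rfl⟩ := huf
    obtain ⟨F, rfl⟩ := Multiset.exists_cons_of_mem hf
    obtain ⟨m, rfl⟩ := Multiset.exists_cons_of_mem hu
    have hup : G.Adj u p := hF _ hf
    have hpair : ∀ a b : V, (s(a, b)).toMultiset = a ::ₘ b ::ₘ 0 := fun _ _ => rfl
    rw [Multiset.cons_bind, hpair, Multiset.cons_add, Multiset.cons_add, Multiset.cons_add,
      Multiset.cons_le_cons_iff, zero_add] at hle
    have hp := Multiset.mem_of_le hle (Multiset.mem_cons_self _ _)
    rcases Multiset.mem_add.1 hp with hp | hp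
    · exact ⟨u, p, [], Multiset.cons_le_cons _ (Multiset.singleton_le.2 hp), hup, by simp, by simp⟩
    obtain ⟨i, hi, hpi⟩ := Multiset.mem_sum.1 hp
    obtain ⟨q, hq⟩ := Sym2.mem_toMultiset.1 hpi
    -- Trade `u` for `q`, removing the edges `s(u, p)` and `e i = s(p, q)`.
    have hle' : F.bind Sym2.toMultiset ≤ q ::ₘ m + ∑ i ∈ T.erase i, (e i).toMultiset := by
      rw [← Finset.add_sum_erase _ _ hi, hq, hpair] at hle
      rw [← Multiset.cons_le_cons_iff p]
      refine hle.trans (le_of_eq ?_)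
      simp only [← Multiset.singleton_add]
      abel
    have hT := Finset.card_erase_add_one hi
    obtain ⟨u', v', l, hm, hl, hnd, hlT⟩ := ih (T.erase i) (Finset.erase_ssubset hi) (q ::ₘ m) F
      (fun f hf => hF f (Multiset.mem_cons_of_mem hf))
      (by rw [Multiset.card_cons] at hcard; omega) hle'
    -- A walk starting at `q` extends to one starting at `u`.
    have key : ∀ w l, {q, w} ≤ q ::ₘ m → IsAlternatingWalk G e q l w → (labels l).Nodup →
        (∀ j ∈ labels l, j ∈ T.erase i) → ∃ u' v' l, {u', v'} ≤ u ::ₘ m ∧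
          IsAlternatingWalk G e u' l v' ∧ (labels l).Nodup ∧ ∀ i ∈ labels l, i ∈ T := by
      intro w l hm hl hnd hlT
      refine ⟨u, w, (p, q, i) :: l, ?_, ⟨hup, hq.symm, hl⟩, ?_, ?_⟩
      · exact Multiset.cons_le_cons _ ((Multiset.cons_le_cons_iff q).1 hm)
      · exact List.nodup_cons.2 ⟨fun h => by simpa using hlT _ h, hnd⟩
      · intro j hj
        rcases List.mem_cons.1 hj with rfl | hj
        · exact hi
        · exact Finset.mem_of_mem_erase (hlT j hj)
    by_cases hqu : q = u'
    · subst hqu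
      exact key v' l hm hl hnd hlT
    by_cases hqv : q = v'
    · subst hqv
      refine key u' _ (by rwa [Multiset.pair_comm]) hl.reverse ?_ ?_
      · rwa [labels_reverse, List.nodup_reverse]
      · intro j hj
        rw [labels_reverse, List.mem_reverse] at hj
        exact hlT j hj
    · refine ⟨u', v', l, ?_, hl, hnd, fun j hj => Finset.mem_of_mem_erase (hlT j hj)⟩
      exact ((Multiset.le_cons_of_notMem (by simp [hqu, hqv])).1 hm).trans (Multiset.le_cons_self _ _)


/-! ### Monomials in powers of an edge ideal -/

section

variable {K : Type*} [Field K] {V : Type*}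

theorem prod_map_X_eq_monomial [DecidableEq V] (m : Multiset V) :
    (m.map MvPolynomial.X).prod =
      (MvPolynomial.monomial (Multiset.toFinsupp m) 1 : MvPolynomial V K) := by
  induction m using Multiset.induction_on with
  | empty => simp
  | cons v m ih =>
    rw [Multiset.map_cons, Multiset.prod_cons, ih, ← Multiset.singleton_add, map_add,
      Multiset.toFinsupp_singleton, MvPolynomial.X, MvPolynomial.monomial_mul, one_mul]

theorem edgeMonomial_eq_prod (e : Sym2 V) :
    edgeMonomial K e = (e.toMultiset.map MvPolynomial.X).prod := by
  induction e with
  | _ u v => exact (Multiset.prod_pair (MvPolynomial.X u : MvPolynomial V K) (MvPolynomial.X v)).symm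

theorem edgeIdeal_pow_le_span (K : Type*) [Field K] [DecidableEq V] (G : SimpleGraph V) (n : ℕ) :
    edgeIdeal K G ^ n ≤ Ideal.span ((fun a => MvPolynomial.monomial a (1 : K)) ''
      {a | ∃ F : Multiset (Sym2 V), (∀ f ∈ F, f ∈ G.edgeSet) ∧ F.card = n ∧
        a = Multiset.toFinsupp (F.bind Sym2.toMultiset)}) := by
  induction n with
  | zero =>
    have h1 : (1 : MvPolynomial V K) ∈ Ideal.span ((fun a => MvPolynomial.monomial a (1 : K)) ''
        {a | ∃ F : Multiset (Sym2 V), (∀ f ∈ F, f ∈ G.edgeSet) ∧ F.card = 0 ∧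
          a = Multiset.toFinsupp (F.bind Sym2.toMultiset)}) :=
      Ideal.subset_span ⟨0, ⟨0, by simp, by simp, by simp⟩, by simp⟩
    rw [(Ideal.eq_top_iff_one _).2 h1]
    exact le_top
  | succ n ih =>
    rw [pow_succ]
    refine (Ideal.mul_mono_left ih).trans ?_
    rw [edgeIdeal, Ideal.span_mul_span', Ideal.span_le]
    rintro _ ⟨_, ⟨_, ⟨F, hF, hn, rfl⟩, rfl⟩, _, ⟨f, hf, rfl⟩, rfl⟩
    refine Ideal.subset_span ⟨_, ⟨f ::ₘ F, ?_, by simp [hn], rfl⟩, ?_⟩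
    · intro g hg
      rcases Multiset.mem_cons.1 hg with rfl | hg
      exacts [hf, hF g hg]
    · simp only [edgeMonomial_eq_prod, prod_map_X_eq_monomial, MvPolynomial.monomial_mul, mul_one,
        Multiset.cons_bind, map_add]
      rw [add_comm]

theorem exists_edges_le_of_prod_mem_pow {G : SimpleGraph V} {n : ℕ} {m : Multiset V}
    (h : (m.map MvPolynomial.X).prod ∈ edgeIdeal K G ^ n) :
    ∃ F : Multiset (Sym2 V), (∀ f ∈ F, f ∈ G.edgeSet) ∧ F.card = n ∧
      F.bind Sym2.toMultiset ≤ m := by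
  classical
  have h' := edgeIdeal_pow_le_span K G n h
  rw [prod_map_X_eq_monomial, MvPolynomial.mem_ideal_span_monomial_image] at h'
  obtain ⟨_, ⟨F, hF, hn, rfl⟩, hle⟩ := h' (Multiset.toFinsupp m) (by
    rw [MvPolynomial.support_monomial, if_neg one_ne_zero]
    exact Finset.mem_singleton_self _)
  exact ⟨F, hF, hn, Finsupp.orderIsoMultiset.symm.le_iff_le.1 hle⟩

/-! ### The colon ideal and alternating walks -/

theorem mem_edgeColon_iff {G : SimpleGraph V} {s : ℕ} {e : Fin s → Sym2 V}
    {f : MvPolynomial V K} :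
    f ∈ edgeColon K G e ↔ f * ∏ i, edgeMonomial K (e i) ∈ edgeIdeal K G ^ (s + 1) := by
  rw [edgeColon, Submodule.mem_colon_singleton, smul_eq_mul]

theorem IsAlternatingWalk.mul_prod_mem {ι : Type*} {G : SimpleGraph V} {e : ι → Sym2 V}
    {l : List (V × V × ι)} {u v : V} (h : IsAlternatingWalk G e u l v) :
    MvPolynomial.X u * MvPolynomial.X v * ((labels l).map fun i => edgeMonomial K (e i)).prod ∈
      edgeIdeal K G ^ (l.length + 1) := by
  induction l generalizing u with
  | nil =>
    have := edgeMonomial_mem_edgeIdeal K (e := s(u, v)) (show G.Adj u v from h)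
    rw [edgeMonomial_mk] at this
    simpa using this
  | cons x l ih =>
    obtain ⟨p, q, i⟩ := x
    obtain ⟨hup, hpq, hl⟩ := h
    have h1 := edgeMonomial_mem_edgeIdeal K (e := s(u, p)) hup
    have h2 := Ideal.mul_mem_mul h1 (ih hl)
    rw [← pow_succ'] at h2
    simp only [labels, List.map_cons, List.prod_cons, List.length_cons]
    rw [← hpq]
    simp only [edgeMonomial_mk] at h2 ⊢
    convert! h2 using 1
    ring

theorem IsAlternatingWalk.mul_mem_edgeColon {G : SimpleGraph V} {s : ℕ} {e : Fin s → Sym2 V}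
    (he : ∀ i, e i ∈ G.edgeSet) {l : List (V × V × Fin s)} {u v : V}
    (h : IsAlternatingWalk G e u l v) (hl : (labels l).Nodup) :
    edgeMonomial K s(u, v) ∈ edgeColon K G e := by
  classical
  rw [mem_edgeColon_iff, edgeMonomial_mk, ← Finset.prod_mul_prod_compl (labels l).toFinset,
    List.prod_toFinset _ hl, ← mul_assoc]
  have h1 : ∏ i ∈ (labels l).toFinsetᶜ, edgeMonomial K (e i) ∈
      edgeIdeal K G ^ (labels l).toFinsetᶜ.card := by
    rw [← Finset.prod_const]
    exact Ideal.prod_mem_prod fun i _ => edgeMonomial_mem_edgeIdeal K (he i)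
  have h2 := Ideal.mul_mem_mul (h.mul_prod_mem (K := K)) h1
  rw [← pow_add] at h2
  have h3 : l.length + 1 + (labels l).toFinsetᶜ.card = s + 1 := by
    have := Finset.card_add_card_compl (labels l).toFinset
    rw [List.toFinset_card_of_nodup hl, List.length_map, Fintype.card_fin] at this
    omega
  rwa [h3] at h2

theorem exists_isAlternatingWalk_of_prod_mem_edgeColon {G : SimpleGraph V} {s : ℕ}
    {e : Fin s → Sym2 V} {t : Finset V}
    (h : ∏ v ∈ t, (MvPolynomial.X v : MvPolynomial V K) ∈ edgeColon K G e) :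
    ∃ u ∈ t, ∃ v ∈ t, u ≠ v ∧ ∃ l, IsAlternatingWalk G e u l v ∧ (labels l).Nodup := by
  have hprod : ∏ i, edgeMonomial K (e i) =
      ((∑ i, (e i).toMultiset).map MvPolynomial.X).prod := by
    simp only [edgeMonomial_eq_prod]
    have := map_sum (Multiset.mapAddMonoidHom (MvPolynomial.X : V → MvPolynomial V K))
      (fun i => (e i).toMultiset) Finset.univ
    simp only [Multiset.coe_mapAddMonoidHom] at this
    rw [this, Multiset.prod_sum]
  rw [mem_edgeColon_iff, hprod, Finset.prod, ← Multiset.prod_add, ← Multiset.map_add] at h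
  obtain ⟨F, hF, hn, hle⟩ := exists_edges_le_of_prod_mem_pow h
  obtain ⟨u, v, l, huv, hl, hnd, -⟩ := exists_isAlternatingWalk Finset.univ t.val F hF
    (by simpa using hn) hle
  have hne : u ≠ v := by
    have := Multiset.nodup_of_le huv t.nodup
    rintro rfl
    simp at this
  exact ⟨u, Multiset.mem_of_le huv (by simp), v, Multiset.mem_of_le huv (by simp), hne, l, hl, hnd⟩

/-- A squarefree monomial ideal containing the square of a variable contains the variable, or `1`;
but every squarefree monomial in the colon ideal has two distinct variables. -/
theorem edgeMonomial_diag_notMem_edgeColon {G : SimpleGraph V} {s : ℕ} {e : Fin s → Sym2 V}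
    (hsq : IsSquarefreeMonomialIdeal (edgeColon K G e)) (d : V) :
    edgeMonomial K s(d, d) ∉ edgeColon K G e := by
  classical
  intro hd
  obtain ⟨S, hS⟩ := hsq
  have himg : (fun t : Finset V => ∏ v ∈ t, (MvPolynomial.X v : MvPolynomial V K)) '' S =
      (fun a => MvPolynomial.monomial a (1 : K)) ''
        ((fun t : Finset V => Multiset.toFinsupp t.val) '' S) := by
    rw [Set.image_image]
    exact Set.image_congr' fun t => prod_map_X_eq_monomial t.val
  have hd' := hd
  rw [hS, himg, edgeMonomial_eq_prod, prod_map_X_eq_monomial,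
    MvPolynomial.mem_ideal_span_monomial_image] at hd'
  obtain ⟨_, ⟨t, ht, rfl⟩, hle⟩ := hd' (Multiset.toFinsupp (s(d, d)).toMultiset) (by
    rw [MvPolynomial.support_monomial, if_neg one_ne_zero]
    exact Finset.mem_singleton_self _)
  replace hle := Finsupp.orderIsoMultiset.symm.le_iff_le.1 hle
  have htd : ∀ v ∈ t, v = d := fun v hv => by
    simpa using Sym2.mem_toMultiset.1 (Multiset.mem_of_le hle hv)
  have htJ : ∏ v ∈ t, (MvPolynomial.X v : MvPolynomial V K) ∈ edgeColon K G e := by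
    rw [hS]
    exact Ideal.subset_span ⟨t, ht, rfl⟩
  obtain ⟨u, hu, v, hv, huv, -⟩ := exists_isAlternatingWalk_of_prod_mem_edgeColon htJ
  exact huv ((htd u hu).trans (htd v hv).symm)

theorem associatedGraph_edgeColon_adj_iff {G : SimpleGraph V} {s : ℕ} {e : Fin s → Sym2 V}
    (he : ∀ i, e i ∈ G.edgeSet) {u v : V} :
    (associatedGraph (edgeColon K G e)).Adj u v ↔
      u ≠ v ∧ ∃ l, IsAlternatingWalk G e u l v ∧ (labels l).Nodup := by
  classical
  refine and_congr_right fun hne => ⟨fun h => ?_, fun ⟨l, hl, hnd⟩ => hl.mul_mem_edgeColon he hnd⟩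
  rw [edgeMonomial_mk, ← Finset.prod_pair hne] at h
  obtain ⟨a, ha, b, hb, hab, l, hl, hnd⟩ := exists_isAlternatingWalk_of_prod_mem_edgeColon h
  simp only [Finset.mem_insert, Finset.mem_singleton] at ha hb
  rcases ha with rfl | rfl <;> rcases hb with rfl | rfl
  · exact absurd rfl hab
  · exact ⟨l, hl, hnd⟩
  · exact ⟨_, hl.reverse, by rwa [labels_reverse, List.nodup_reverse]⟩
  · exact absurd rfl hab

theorem edgeIdeal_associatedGraph_edgeColon {G : SimpleGraph V} {s : ℕ} {e : Fin s → Sym2 V}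
    (he : ∀ i, e i ∈ G.edgeSet) (hsq : IsSquarefreeMonomialIdeal (edgeColon K G e)) :
    edgeIdeal K (associatedGraph (edgeColon K G e)) = edgeColon K G e := by
  classical
  apply le_antisymm
  · refine Ideal.span_le.2 ?_
    rintro _ ⟨f, hf, rfl⟩
    induction f with
    | _ u v => exact hf.2
  · obtain ⟨S, hS⟩ := hsq
    refine hS.le.trans (Ideal.span_le.2 ?_)
    rintro _ ⟨t, ht, rfl⟩
    have htJ : ∏ v ∈ t, (MvPolynomial.X v : MvPolynomial V K) ∈ edgeColon K G e := by
      rw [hS]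
      exact Ideal.subset_span ⟨t, ht, rfl⟩
    obtain ⟨u, hu, v, hv, huv, h⟩ := exists_isAlternatingWalk_of_prod_mem_edgeColon htJ
    have hadj := (associatedGraph_edgeColon_adj_iff (K := K) he).2 ⟨huv, h⟩
    refine Ideal.mem_of_dvd _ ?_ (edgeMonomial_mem_edgeIdeal K (e := s(u, v)) hadj)
    rw [edgeMonomial_mk, ← Finset.prod_pair huv]
    exact Finset.prod_dvd_prod_of_subset _ _ _ (by
      intro x hx
      rcases Finset.mem_insert.1 hx with rfl | hx
      · exact hu
      · rwa [Finset.mem_singleton.1 hx])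

theorem IsFavaronMatching.associatedGraph_edgeColon {G : SimpleGraph V} {m : V → V}
    (hm : IsFavaronMatching G m) {s : ℕ} {e : Fin s → Sym2 V} (he : ∀ i, e i ∈ G.edgeSet)
    (hsq : IsSquarefreeMonomialIdeal (edgeColon K G e)) :
    IsFavaronMatching (associatedGraph (edgeColon K G e)) m where
  involutive := hm.involutive
  adj v := (associatedGraph_edgeColon_adj_iff he).2
    ⟨(hm.adj v).ne, [], hm.adj v, List.nodup_nil⟩
  adj_of_adj v a b hav hbv := by
    obtain ⟨-, l, hl, -⟩ := (associatedGraph_edgeColon_adj_iff he).1 hav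
    obtain ⟨-, l', hl', -⟩ := (associatedGraph_edgeColon_adj_iff he).1 hbv.symm
    have hclosed : ∀ d l, IsAlternatingWalk G e d l d → ¬ (labels l).Nodup := fun d l h hnd =>
      edgeMonomial_diag_notMem_edgeColon hsq d (h.mul_mem_edgeColon he hnd)
    -- The walks are joined across the matching edge of `v`; some `e i` may then be passed twice.
    rcases (hl.append (hm.adj_of_adj (v := v)) hl').exists_nodup with ⟨l, h, hnd⟩ | ⟨d, l, h, hnd⟩
    · refine (associatedGraph_edgeColon_adj_iff he).2 ⟨?_, l, h, hnd⟩
      rintro rfl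
      exact hclosed a l h hnd
    · exact absurd hnd (hclosed d l h)

end

end EdgeIdealPowers

theorem corollaryg {K : Type*} [Field K] {V : Type*} [Fintype V] (G : SimpleGraph V)
    (hG : EdgeIdealPowers.IsVeryWellCovered K G)
    (s : ℕ) (hs : 1 ≤ s) (e : Fin s → Sym2 V) (he : ∀ i, e i ∈ G.edgeSet)
    (hsq : EdgeIdealPowers.IsSquarefreeMonomialIdeal (EdgeIdealPowers.edgeColon K G e)) :
    EdgeIdealPowers.edgeIdeal K
        (EdgeIdealPowers.associatedGraph (EdgeIdealPowers.edgeColon K G e)) =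
      EdgeIdealPowers.edgeColon K G e ∧
    EdgeIdealPowers.IsVeryWellCovered K
      (EdgeIdealPowers.associatedGraph (EdgeIdealPowers.edgeColon K G e)) := by
  obtain ⟨m, hm⟩ := hG.exists_isFavaronMatching
  exact ⟨EdgeIdealPowers.edgeIdeal_associatedGraph_edgeColon he hsq,
    (hm.associatedGraph_edgeColon he hsq).isVeryWellCovered K⟩
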